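/- Let $n,M\ge 1$ be integers, $\sigma\ge 0$, let $\mathcal X$ be a set and let $x_1,\dots,x_n\in\mathcal X$ be deterministic design points. For $\eta:\mathcal X\to\mathbb R$ one observes $Y_i=\eta(x_i)+\xi_i$, $i=1,\dots,n$, where $\xi_1,\dots,\xi_n$ are independent $\mathcal N(0,\sigma^2)$ random variables; $\mathbb E$ denotes the corresponding expectation. For $f:\mathcal X\to\mathbb R$ put $\|f\|^2=\frac1n\sum_{i=1}^n f(x_i)^2$ and $R(f)=\|f-\eta\|^2$. A dictionary is a family $\mathcal H=\{f_1,\dots,f_M\}$ of functions $\mathcal X\to\mathbb R$. An empirical risk minimizer $\hat f^{\mathrm{ERM}}$ is a (measurable) minimizer of $f\mapsto\frac1n\sum_{i=1}^n(Y_i-f(x_i))^2$ over $f\in\mathcal H$, with ties broken arbitrarily. A selector $\hat S_n$ is an estimator, that is, a measurable function of $(Y_1,\dots,Y_n)$, with values in $\mathcal H$. (i) If $\|f_j\|\le 1$ for $j=1,\dots,M$, then for every $\eta$ any empirical risk minimizer satisfies $$\mathbb E R(\hat f^{\mathrm{ERM}})\le\min_{1\le j\le M}R(f_j)+4\sigma\sqrt{\frac{2\log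 M}{n}}.$$ (ii) There are absolute constants $C_0\in(0,1)$ and $C_*>0$ such that the following holds. If $x_1,\dots,x_n$ are distinct and $(\sigma\vee 1)\sqrt{(\log M)/n}\le C_0$, then there is a dictionary $\mathcal H=\{f_1,\dots,f_M\}$ of $M$ distinct functions with $\|f_j\|\le 1$, $j=1,\dots,M$, such that for every selector $\hat S_n$ there is a regression function $\eta$ with $\|\eta\|\le 1$ and $$\mathbb E R(\hat S_n)\ge\min_{1\le j\le M}R(f_j)+C_*\,\sigma\sqrt{\frac{\log M}{n}}.$$ (iii) Consequently, selectors cannot attain the rate $(\log M)/n$: for every $\sigma>0$ and every $C\in\mathbb R$ there is $\delta>0$ such that, whenever $M\ge 2$, $(\log M)/n\le\delta$ and $x_1,\dots,x_n$ are distinct, there is a dictionary of $M$ distinct functions with $\|f_j\|\le1$ such that for every selector $\hat S_n$ there is $\eta$ with $\|\eta\|\le 1$ and $\mathbb E R(\hat S_n)>\min_{1\le j\le M}R(f_j)+C\,\frac{\log M}{n}$. -/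

import Mathlib

open MeasureTheory ProbabilityTheory
open scoped NNReal

universe u v

noncomputable section

namespace FixedDesign

variable {𝒳 : Type u} {n M : ℕ}

/-- The empirical seminorm `‖g‖` at the design points: `‖g‖² = (1/n) ∑ᵢ g(xᵢ)²`. -/
def empNorm (x : Fin n → 𝒳) (g : 𝒳 → ℝ) : ℝ :=
  Real.sqrt ((1 / (n : ℝ)) * ∑ i, g (x i) ^ 2)

/-- The averaged squared error `R(g) = ‖g - η‖² = (1/n) ∑ᵢ (g(xᵢ) - η(xᵢ))²`. -/
def risk (x : Fin n → 𝒳) (η g : 𝒳 → ℝ) : ℝ :=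
  (1 / (n : ℝ)) * ∑ i, (g (x i) - η (x i)) ^ 2

/-- The empirical risk `(1/n) ∑ᵢ (Yᵢ - g(xᵢ))²` of `g` for the observations `y`. -/
def empRisk (x : Fin n → 𝒳) (y : Fin n → ℝ) (g : 𝒳 → ℝ) : ℝ :=
  (1 / (n : ℝ)) * ∑ i, (y i - g (x i)) ^ 2

/-- The joint law of the observations `Yᵢ = η(xᵢ) + ξᵢ`, where the `ξᵢ` are independent
`N(0, σ²)`: the `Yᵢ` are independent with laws `N(η(xᵢ), σ²)`. -/
def dataLaw (x : Fin n → 𝒳) (η : 𝒳 → ℝ) (σ : ℝ≥0) : Measure (Fin n → ℝ) :=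
  Measure.pi fun i => gaussianReal (η (x i)) (σ ^ 2)

/-- `fhat` is an empirical risk minimizer over the dictionary `f` for the observations `Y`. It is
defined on the underlying probability space, so ties may be broken in any measurable way, even a
randomized one. -/
structure IsERM {Ω : Type v} [MeasurableSpace Ω] (x : Fin n → 𝒳) (f : Fin M → 𝒳 → ℝ)
    (Y : Ω → Fin n → ℝ) (fhat : Ω → 𝒳 → ℝ) : Prop where
  mem : ∀ ω, fhat ω ∈ Set.range f
  le : ∀ ω j, empRisk x (Y ω) (fhat ω) ≤ empRisk x (Y ω) (f j)
  measurable : ∀ i, Measurable fun ω => fhat ω (x i)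

/-- A selector: an estimator (measurable function of the observations) with values in the
dictionary `f`. -/
structure IsSelector (x : Fin n → 𝒳) (f : Fin M → 𝒳 → ℝ)
    (S : (Fin n → ℝ) → 𝒳 → ℝ) : Prop where
  mem : ∀ y, S y ∈ Set.range f
  measurable : ∀ i, Measurable fun y => S y (x i)

end FixedDesign

end

/-!
Upper bound. Comparing the empirical risks of the minimizer `fhat` and of a fixed `f j` bounds the
excess risk by the noise term `(2 / n) ∑ᵢ (fhat - f j)(xᵢ) ξᵢ`, which is one of `M` centred Gaussian
variables, those with `f k` in place of `fhat`, of variance at most `16 σ² / n`. Their maximum has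
expectation at most `4 σ √(2 log M / n)` by the usual exponential moment argument
(`integral_risk_erm_le`).

Lower bound. If `n` is large compared with `log M`, the cube `{-1, 1}ⁿ` contains `M` vertices with
pairwise normalized inner products at most `1 / 2` (`exists_separated_signVectors`). The dictionary
consists of functions `f k` with these values at the design points, all of norm one. For the
regression function `η = t f k` with `t` of order `σ √(log M / n)` the functions `f j`, `j ≠ k`,
have risk larger than `f k` by at least `t` (`risk_add_le_of_separated`): the loss is linear in `t`,
not quadratic, since `η` is far from the dictionary. So a selector that does not pay order `t` has
to recover `k`. But the likelihood ratio of the law for `k` with respect to pure noise has second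
moment `exp (n t² / σ²)`, a small power of `M`, which by Cauchy–Schwarz prevents recovery with
probability above `4 / 5` for all `k` at once (`sum_withDensity_disjoint_le`).

The statement on the rate `log M / n` follows because `√r` dominates every multiple of `r` near `0`.
-/

namespace FixedDesign

/-! ### Exponential moments and likelihood ratios of Gaussian product laws -/

section Gaussian

variable {n : ℕ} {v : ℝ≥0}

theorem integrable_exp_sum_pi_gaussian (a c : Fin n → ℝ) (v : ℝ≥0) :
    Integrable (fun y : Fin n → ℝ => Real.exp (∑ i, c i * y i))
      (Measure.pi fun i => gaussianReal (a i) v) := by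
  simp_rw [Real.exp_sum]
  exact Integrable.fintype_prod (f := fun i y => Real.exp (c i * y))
    fun i => integrable_exp_mul_gaussianReal (c i)

theorem integral_exp_sum_pi_gaussian (a c : Fin n → ℝ) (v : ℝ≥0) :
    ∫ y : Fin n → ℝ, Real.exp (∑ i, c i * y i) ∂(Measure.pi fun i => gaussianReal (a i) v) =
      Real.exp (∑ i, (a i * c i + v * c i ^ 2 / 2)) := by
  simp_rw [Real.exp_sum]
  rw [integral_fintype_prod_eq_prod (f := fun i y => Real.exp (c i * y))]
  refine Finset.prod_congr rfl fun i _ => ?_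
  have h := congrFun (mgf_id_gaussianReal (μ := a i) (v := v)) (c i)
  simpa [mgf] using h

theorem gaussianReal_eq_withDensity (m : ℝ) {v : ℝ≥0} (hv : v ≠ 0) :
    gaussianReal m v = (gaussianReal 0 v).withDensity
      fun y => ENNReal.ofReal (Real.exp (m / v * y - m ^ 2 / (2 * v))) := by
  rw [gaussianReal_of_var_ne_zero _ hv, gaussianReal_of_var_ne_zero _ hv,
    ← withDensity_mul _ (measurable_gaussianPDF _ _) (by fun_prop)]
  congr 1
  ext y
  have hv' : (v : ℝ) ≠ 0 := by exact_mod_cast hv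
  simp only [gaussianPDF, Pi.mul_apply, gaussianPDFReal]
  rw [← ENNReal.ofReal_mul (by positivity), mul_assoc _ (Real.exp _) (Real.exp _), ← Real.exp_add]
  congr 3
  field_simp
  ring

/-- Densities multiply under finite products of probability measures. -/
theorem pi_withDensity_ofReal {ι : Type*} [Fintype ι] {E : Type*} [MeasurableSpace E]
    (μ : ι → Measure E) [∀ i, IsProbabilityMeasure (μ i)] (g : ι → E → ℝ)
    (hg : ∀ i y, 0 ≤ g i y) (hi : ∀ i, Integrable (g i) (μ i))
    [∀ i, SigmaFinite ((μ i).withDensity fun y => ENNReal.ofReal (g i y))] :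
    Measure.pi (fun i => (μ i).withDensity fun y => ENNReal.ofReal (g i y)) =
      (Measure.pi μ).withDensity fun y => ENNReal.ofReal (∏ i, g i (y i)) := by
  refine Measure.pi_eq fun s hs => ?_
  rw [withDensity_apply _ (MeasurableSet.univ_pi hs), Measure.restrict_pi_pi,
    ← ofReal_integral_eq_lintegral_ofReal
      (Integrable.fintype_prod fun i => (hi i).restrict)
      (ae_of_all _ fun y => Finset.prod_nonneg fun i _ => hg i _),
    integral_fintype_prod_eq_prod,
    ENNReal.ofReal_prod_of_nonneg fun i _ => integral_nonneg (hg i)]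
  refine Finset.prod_congr rfl fun i _ => ?_
  rw [withDensity_apply _ (hs i), ofReal_integral_eq_lintegral_ofReal (hi i).restrict
    (ae_of_all _ (hg i))]

/-- The likelihood ratio of the Gaussian shift by `a` with respect to the centred law. -/
noncomputable def likelihoodRatio (v : ℝ≥0) (a y : Fin n → ℝ) : ℝ :=
  Real.exp (∑ i, (a i / v * y i - a i ^ 2 / (2 * v)))

theorem pi_gaussianReal_eq_withDensity (a : Fin n → ℝ) (hv : v ≠ 0) :
    (Measure.pi fun i => gaussianReal (a i) v) =
      (Measure.pi fun _ => gaussianReal 0 v).withDensity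
        fun y => ENNReal.ofReal (likelihoodRatio v a y) := by
  have key : ∀ i, (gaussianReal 0 v).withDensity
      (fun y => ENNReal.ofReal (Real.exp (a i / v * y - a i ^ 2 / (2 * v)))) =
      gaussianReal (a i) v := fun i => (gaussianReal_eq_withDensity (a i) hv).symm
  have : ∀ i, SigmaFinite ((gaussianReal 0 v).withDensity
      (fun y => ENNReal.ofReal (Real.exp (a i / v * y - a i ^ 2 / (2 * v))))) := by
    intro i; rw [key]; infer_instance
  have h := pi_withDensity_ofReal (fun _ : Fin n => gaussianReal 0 v)
    (fun i y => Real.exp (a i / v * y - a i ^ 2 / (2 * v))) (fun _ _ => (Real.exp_pos _).le)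
    (fun i => by
      simp_rw [Real.exp_sub]
      exact (integrable_exp_mul_gaussianReal _).div_const _)
  simp_rw [key] at h
  rw [h]
  simp_rw [likelihoodRatio, Real.exp_sum]

theorem likelihoodRatio_sq (a y : Fin n → ℝ) :
    likelihoodRatio v a y ^ 2 =
      Real.exp (-∑ i, a i ^ 2 / v) * Real.exp (∑ i, 2 * (a i / v) * y i) := by
  rw [likelihoodRatio, ← Real.exp_nat_mul, ← Real.exp_add]
  congr 1
  rw [Finset.mul_sum, ← Finset.sum_neg_distrib, ← Finset.sum_add_distrib]
  refine Finset.sum_congr rfl fun i _ => ?_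
  push_cast
  ring

theorem integrable_likelihoodRatio_sq (a : Fin n → ℝ) :
    Integrable (fun y => likelihoodRatio v a y ^ 2) (Measure.pi fun _ => gaussianReal 0 v) := by
  simp_rw [likelihoodRatio_sq]
  exact (integrable_exp_sum_pi_gaussian _ _ _).const_mul _

theorem integral_likelihoodRatio_sq (a : Fin n → ℝ) (hv : v ≠ 0) :
    ∫ y, likelihoodRatio v a y ^ 2 ∂(Measure.pi fun _ => gaussianReal 0 v) =
      Real.exp ((∑ i, a i ^ 2) / v) := by
  have hv' : (v : ℝ) ≠ 0 := by exact_mod_cast hv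
  simp_rw [likelihoodRatio_sq]
  rw [integral_const_mul, integral_exp_sum_pi_gaussian (fun _ => 0), ← Real.exp_add,
    ← Finset.sum_neg_distrib, ← Finset.sum_add_distrib, Finset.sum_div]
  congr 1
  refine Finset.sum_congr rfl fun i _ => ?_
  field_simp
  ring

end Gaussian

/-! ### Testing many hypotheses by second moments of likelihood ratios -/

/-- If the likelihood ratios `L k` have second moments at most `B`, then disjoint acceptance
regions `A k` satisfy `∑ k, P_k (A k) ≤ √(M B)`. This plays the role of Fano's inequality. -/
theorem sum_withDensity_disjoint_le {Ω : Type*} [MeasurableSpace Ω] {M : ℕ} (hM : 1 ≤ M)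
    (Q : Measure Ω) [IsProbabilityMeasure Q] (L : Fin M → Ω → ℝ) (hL : ∀ k y, 0 ≤ L k y)
    (hLm : ∀ k, Measurable (L k)) (hLi : ∀ k, Integrable (fun y => L k y ^ 2) Q) {B : ℝ}
    (hB : 0 < B) (hLB : ∀ k, ∫ y, L k y ^ 2 ∂Q ≤ B) (A : Fin M → Set Ω)
    (hA : ∀ k, MeasurableSet (A k)) (hd : Pairwise fun j k => Disjoint (A j) (A k)) :
    ∑ k, (Q.withDensity fun y => ENNReal.ofReal (L k y)).real (A k) ≤ Real.sqrt (M * B) := by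
  have hM' : (0 : ℝ) < M := by exact_mod_cast hM
  set a := Real.sqrt (M * B) with ha
  have ha0 : 0 < a := Real.sqrt_pos.2 (by positivity)
  have ha2 : a ^ 2 = M * B := Real.sq_sqrt (by positivity)
  have h1 : ∀ k, (Q.withDensity fun y => ENNReal.ofReal (L k y)).real (A k) ≤
      B / (2 * a) + a / 2 * Q.real (A k) := by
    intro k
    have hLi1 : Integrable (L k) Q :=
      ((memLp_two_iff_integrable_sq (hLm k).aestronglyMeasurable).2 (hLi k)).integrable
        (by norm_num)
    have e : (Q.withDensity fun y => ENNReal.ofReal (L k y)).real (A k) =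
        ∫ y in A k, L k y ∂Q := by
      rw [measureReal_def, withDensity_apply _ (hA k),
        integral_eq_lintegral_of_nonneg_ae (ae_of_all _ (hL k))
          (hLm k).aestronglyMeasurable.restrict]
    rw [e]
    -- `2 a L ≤ L² + a²` does the work of Cauchy–Schwarz once `a` balances the two sums over `k`
    calc ∫ y in A k, L k y ∂Q
        ≤ ∫ y in A k, (1 / (2 * a) * L k y ^ 2 + a / 2) ∂Q := by
          refine integral_mono hLi1.restrict
            (((hLi k).restrict.const_mul _).add (integrable_const _)) fun y => ?_
          have : 0 ≤ (L k y - a) ^ 2 / (2 * a) := by positivity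
          have e2 : (L k y - a) ^ 2 / (2 * a) = 1 / (2 * a) * L k y ^ 2 + a / 2 - L k y := by
            field_simp; ring
          simp only
          linarith
      _ = 1 / (2 * a) * ∫ y in A k, L k y ^ 2 ∂Q + a / 2 * Q.real (A k) := by
          rw [integral_add ((hLi k).restrict.const_mul _) (integrable_const _),
            integral_const_mul]
          simp [mul_comm]
      _ ≤ 1 / (2 * a) * B + a / 2 * Q.real (A k) := by
          have : ∫ y in A k, L k y ^ 2 ∂Q ≤ B :=
            (setIntegral_le_integral (hLi k) (ae_of_all _ fun y => sq_nonneg _)).trans (hLB k)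
          gcongr
      _ = _ := by ring
  have h2 : ∑ k, Q.real (A k) ≤ 1 := by
    rw [← measureReal_biUnion_finset (fun i _ j _ hij => hd hij) fun k _ => hA k]
    exact measureReal_le_one
  calc _ ≤ ∑ k, (B / (2 * a) + a / 2 * Q.real (A k)) := Finset.sum_le_sum fun k _ => h1 k
    _ = M * B / (2 * a) + a / 2 * ∑ k, Q.real (A k) := by
        rw [Finset.sum_add_distrib, Finset.mul_sum]; simp; ring
    _ ≤ M * B / (2 * a) + a / 2 * 1 := by gcongr
    _ = a := by rw [← ha2]; field_simp; ring

/-! ### A well-separated family of sign vectors -/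

section Packing

/-- The vertices of the cube `{-1, 1}ⁿ`. -/
noncomputable def signVectors (n : ℕ) : Finset (Fin n → ℝ) := Fintype.piFinset fun _ => {1, -1}

theorem mem_signVectors {n : ℕ} {w : Fin n → ℝ} :
    w ∈ signVectors n ↔ ∀ i, w i = 1 ∨ w i = -1 := by
  simp [signVectors]

theorem card_signVectors (n : ℕ) : (signVectors n).card = 2 ^ n := by
  have : (1 : ℝ) ≠ -1 := by norm_num
  simp [signVectors, Finset.card_pair this]

/-- Chernoff bound for the uniform distribution on the cube. -/
theorem card_correlated_le {n : ℕ} {w : Fin n → ℝ} (hw : w ∈ signVectors n) :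
    (((signVectors n).filter fun u => (n : ℝ) / 2 < ∑ i, w i * u i).card : ℝ) ≤
      2 ^ n * Real.exp (-(n / 8)) := by
  rw [mem_signVectors] at hw
  have hsum : ∑ u ∈ signVectors n, Real.exp (1 / 2 * ∑ i, w i * u i) ≤
      2 ^ n * Real.exp (n / 8) := by
    have hfac : ∀ u : Fin n → ℝ, Real.exp (1 / 2 * ∑ i, w i * u i) =
        ∏ i, Real.exp (1 / 2 * (w i * u i)) := fun u => by
      rw [Finset.mul_sum, Real.exp_sum]
    simp_rw [hfac]
    rw [signVectors, ← Finset.prod_univ_sum (fun _ : Fin n => ({1, -1} : Finset ℝ))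
      fun i s => Real.exp (1 / 2 * (w i * s))]
    have hi : ∀ i, ∑ s ∈ ({1, -1} : Finset ℝ), Real.exp (1 / 2 * (w i * s)) ≤
        2 * Real.exp (1 / 8) := by
      intro i
      rw [Finset.sum_pair (by norm_num)]
      have hc := Real.cosh_le_exp_half_sq (1 / 2)
      rw [Real.cosh_eq] at hc
      norm_num at hc ⊢
      rcases hw i with h | h <;> rw [h] <;> norm_num <;> linarith
    calc _ ≤ ∏ _i : Fin n, (2 * Real.exp (1 / 8)) :=
          Finset.prod_le_prod (fun i _ => Finset.sum_nonneg fun s _ => (Real.exp_pos _).le)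
            fun i _ => hi i
      _ = _ := by
          rw [Finset.prod_const, Finset.card_univ, Fintype.card_fin, mul_pow, ← Real.exp_nat_mul]
          congr 2
          ring
  have hlow : (((signVectors n).filter fun u => (n : ℝ) / 2 < ∑ i, w i * u i).card : ℝ) *
      Real.exp (n / 4) ≤ ∑ u ∈ signVectors n, Real.exp (1 / 2 * ∑ i, w i * u i) := by
    rw [← nsmul_eq_mul, ← Finset.sum_const]
    refine (Finset.sum_le_sum fun u hu => ?_).trans
      (Finset.sum_le_sum_of_subset_of_nonneg (Finset.filter_subset _ _)
        fun u _ _ => (Real.exp_pos _).le)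
    rw [Finset.mem_filter] at hu
    exact Real.exp_le_exp.2 (by linarith [hu.2])
  have h4 : Real.exp (-((n : ℝ) / 8)) = Real.exp (n / 8) / Real.exp (n / 4) := by
    rw [← Real.exp_sub]; congr 1; ring
  rw [h4, ← mul_div_assoc, le_div_iff₀ (Real.exp_pos _)]
  exact hlow.trans hsum

/-- Varshamov–Gilbert: the cube contains `M ≤ exp (n / 8)` vertices with pairwise normalized
inner products at most `1 / 2`; they are chosen greedily. -/
theorem exists_separated_signVectors {n : ℕ} :
    ∀ M : ℕ, (M : ℝ) ≤ Real.exp (n / 8) → ∃ w : Fin M → Fin n → ℝ,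
      (∀ j, w j ∈ signVectors n) ∧ ∀ j k, j ≠ k → ∑ i, w j i * w k i ≤ n / 2 := by
  intro M
  induction M with
  | zero => exact fun _ => ⟨fun _ _ => 0, fun j => j.elim0, fun j => j.elim0⟩
  | succ m ih =>
    intro hM
    push_cast at hM
    obtain ⟨w, hw, hsep⟩ := ih (by linarith)
    obtain ⟨u, hu, hu2⟩ : ∃ u ∈ signVectors n, ∀ j, ∑ i, w j i * u i ≤ n / 2 := by
      by_contra! hcon
      have hsub : signVectors n ⊆ Finset.univ.biUnion fun j =>
          (signVectors n).filter fun u => (n : ℝ) / 2 < ∑ i, w j i * u i := by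
        intro u hu
        obtain ⟨j, hj⟩ := hcon u hu
        simp only [Finset.mem_biUnion, Finset.mem_univ, true_and, Finset.mem_filter]
        exact ⟨j, hu, hj⟩
      have h1 := (Finset.card_le_card hsub).trans Finset.card_biUnion_le
      have h2 : (2 : ℝ) ^ n ≤ ∑ _j : Fin m, 2 ^ n * Real.exp (-((n : ℝ) / 8)) := by
        calc (2 : ℝ) ^ n = ((signVectors n).card : ℝ) := by rw [card_signVectors]; norm_num
          _ ≤ ∑ j, (((signVectors n).filter
              fun u => (n : ℝ) / 2 < ∑ i, w j i * u i).card : ℝ) := by exact_mod_cast h1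
          _ ≤ _ := Finset.sum_le_sum fun j _ => card_correlated_le (hw j)
      rw [Finset.sum_const, Finset.card_univ, Fintype.card_fin, nsmul_eq_mul, Real.exp_neg] at h2
      have h3 : (m : ℝ) * (Real.exp (n / 8))⁻¹ < 1 := by
        rw [← div_eq_mul_inv, div_lt_one (Real.exp_pos _)]; linarith
      have h5 : (0 : ℝ) < 2 ^ n := by positivity
      nlinarith
    refine ⟨Fin.snoc (α := fun _ => Fin n → ℝ) w u, fun j => ?_, fun j k => ?_⟩
    · refine Fin.lastCases ?_ (fun j => ?_) j
      · simpa using hu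
      · simpa using hw j
    · refine Fin.lastCases ?_ (fun j => ?_) j <;> refine Fin.lastCases ?_ (fun k => ?_) k
      · simp
      · intro _
        simpa [mul_comm] using hu2 k
      · intro _
        simpa using hu2 j
      · intro hjk
        simpa using hsep j k (by rintro rfl; exact hjk rfl)

end Packing

/-! ### The risk of a random element of a dictionary -/

variable {𝒳 : Type u} {n M : ℕ}

theorem risk_nonneg (x : Fin n → 𝒳) (η g : 𝒳 → ℝ) : 0 ≤ risk x η g := by
  unfold risk; positivity

theorem iInf_risk_le (x : Fin n → 𝒳) (η : 𝒳 → ℝ) (f : Fin M → 𝒳 → ℝ) (k : Fin M) :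
    ⨅ j, risk x η (f j) ≤ risk x η (f k) :=
  ciInf_le (Set.finite_range _).bddBelow k

theorem integrable_risk {Ω : Type v} [MeasurableSpace Ω] {P : Measure Ω} [IsFiniteMeasure P]
    {x : Fin n → 𝒳} {f : Fin M → 𝒳 → ℝ} {g : Ω → 𝒳 → ℝ} (hg : ∀ ω, g ω ∈ Set.range f)
    (hm : ∀ i, Measurable fun ω => g ω (x i)) (η : 𝒳 → ℝ) :
    Integrable (fun ω => risk x η (g ω)) P := by
  refine Integrable.of_bound (C := ∑ j, risk x η (f j)) ?_ (ae_of_all _ fun ω => ?_)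
  · unfold risk
    exact (Measurable.const_mul (Finset.measurable_sum _ fun i _ =>
      ((hm i).sub_const _).pow_const 2) _).aestronglyMeasurable
  · obtain ⟨j, hj⟩ := hg ω
    rw [← hj, Real.norm_of_nonneg (risk_nonneg _ _ _)]
    exact Finset.single_le_sum (f := fun j => risk x η (f j))
      (fun j _ => risk_nonneg _ _ _) (Finset.mem_univ j)

theorem iInf_risk_le_integral {Ω : Type v} [MeasurableSpace Ω] {P : Measure Ω}
    [IsProbabilityMeasure P]
    {x : Fin n → 𝒳} {f : Fin M → 𝒳 → ℝ} {g : Ω → 𝒳 → ℝ} (hg : ∀ ω, g ω ∈ Set.range f)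
    (hm : ∀ i, Measurable fun ω => g ω (x i)) (η : 𝒳 → ℝ) :
    ⨅ j, risk x η (f j) ≤ ∫ ω, risk x η (g ω) ∂P := by
  have h : ∫ _ω, (⨅ j, risk x η (f j)) ∂P ≤ ∫ ω, risk x η (g ω) ∂P := by
    refine integral_mono (integrable_const _) (integrable_risk hg hm η) fun ω => ?_
    obtain ⟨j, hj⟩ := hg ω
    simp only [← hj]
    exact iInf_risk_le x η f j
  simpa using h

instance (x : Fin n → 𝒳) (η : 𝒳 → ℝ) (σ : ℝ≥0) : IsProbabilityMeasure (dataLaw x η σ) := by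
  unfold dataLaw; infer_instance

/-! ### The oracle inequality for empirical risk minimizers -/

/-- Optimization over `lam` of an exponential moment bound. -/
theorem le_mul_sqrt_of_forall_mul_le {z s L : ℝ} (hs : 0 ≤ s) (hL : 0 ≤ L)
    (h : ∀ lam : ℝ, 0 < lam → lam * z ≤ L + lam ^ 2 * s ^ 2 / 2) : z ≤ s * Real.sqrt (2 * L) := by
  by_contra! hz
  have hz0 : 0 < z := lt_of_le_of_lt (by positivity) hz
  rcases hs.eq_or_lt with rfl | hs
  · have := h ((L + 1) / z) (by positivity)
    rw [div_mul_cancel₀ _ hz0.ne'] at this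
    norm_num at this
  · have h1 := h (z / s ^ 2) (by positivity)
    have e1 : z / s ^ 2 * z = z ^ 2 / s ^ 2 := by ring
    have e2 : (z / s ^ 2) ^ 2 * s ^ 2 / 2 = z ^ 2 / s ^ 2 / 2 := by field_simp
    rw [e1, e2] at h1
    have h2 : z ^ 2 / s ^ 2 ≤ 2 * L := by linarith
    rw [div_le_iff₀ (by positivity)] at h2
    have h3 : (s * Real.sqrt (2 * L)) ^ 2 < z ^ 2 := by gcongr
    rw [mul_pow, Real.sq_sqrt (by positivity)] at h3
    linarith

theorem empNorm_le_one_iff (x : Fin n → 𝒳) (hn : 1 ≤ n) {g : 𝒳 → ℝ} :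
    empNorm x g ≤ 1 ↔ ∑ i, g (x i) ^ 2 ≤ n := by
  have hn' : (0 : ℝ) < n := by exact_mod_cast hn
  rw [empNorm, Real.sqrt_le_iff, one_div, inv_mul_le_iff₀ hn']
  simp

/-- The basic inequality: the excess risk of a minimizer is at most a noise term. -/
theorem risk_le_of_empRisk_le {x : Fin n → 𝒳} {η g h : 𝒳 → ℝ} {y : Fin n → ℝ}
    (hle : empRisk x y g ≤ empRisk x y h) :
    risk x η g ≤ risk x η h +
      2 / n * ∑ i, (g (x i) - h (x i)) * (y i - η (x i)) := by
  have e : empRisk x y h - empRisk x y g = risk x η h - risk x η g +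
      2 / n * ∑ i, (g (x i) - h (x i)) * (y i - η (x i)) := by
    simp only [empRisk, risk, Finset.mul_sum, ← Finset.sum_sub_distrib, ← Finset.sum_add_distrib]
    refine Finset.sum_congr rfl fun i _ => ?_
    ring
  linarith

theorem integrable_exp_noise {x : Fin n → 𝒳} {η : 𝒳 → ℝ} {σ : ℝ≥0} (c : Fin n → ℝ) :
    Integrable (fun y : Fin n → ℝ => Real.exp (∑ i, c i * (y i - η (x i))))
      (dataLaw x η σ) := by
  simp_rw [mul_sub, Finset.sum_sub_distrib, Real.exp_sub]
  exact (integrable_exp_sum_pi_gaussian _ _ _).div_const _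

theorem integral_exp_noise {x : Fin n → 𝒳} {η : 𝒳 → ℝ} {σ : ℝ≥0} (c : Fin n → ℝ) :
    ∫ y : Fin n → ℝ, Real.exp (∑ i, c i * (y i - η (x i))) ∂(dataLaw x η σ) =
      Real.exp (σ ^ 2 / 2 * ∑ i, c i ^ 2) := by
  simp_rw [mul_sub, Finset.sum_sub_distrib, Real.exp_sub]
  rw [integral_div, dataLaw, integral_exp_sum_pi_gaussian, ← Real.exp_sub,
    ← Finset.sum_sub_distrib, Finset.mul_sum]
  congr 1
  refine Finset.sum_congr rfl fun i _ => ?_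
  push_cast
  ring

/-- The oracle inequality for a minimizer, against each fixed element of the dictionary. -/
theorem integral_risk_erm_le {Ω : Type v} [MeasurableSpace Ω] {P : Measure Ω}
    [IsProbabilityMeasure P] (hn : 1 ≤ n) {σ : ℝ≥0} {x : Fin n → 𝒳} {η : 𝒳 → ℝ}
    {f : Fin M → 𝒳 → ℝ} (hf : ∀ j, empNorm x (f j) ≤ 1) {Y : Ω → Fin n → ℝ}
    (hY : HasLaw Y (dataLaw x η σ) P) {fhat : Ω → 𝒳 → ℝ} (hfhat : IsERM x f Y fhat)
    (j : Fin M) :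
    ∫ ω, risk x η (fhat ω) ∂P ≤
      risk x η (f j) + 4 * (σ : ℝ) * Real.sqrt (2 * Real.log M / n) := by
  have hn' : (0 : ℝ) < n := by exact_mod_cast hn
  have hM' : (1 : ℝ) ≤ M := by exact_mod_cast (Fin.pos j)
  set s : ℝ := 2 * σ * Real.sqrt n with hs
  have hs2 : s ^ 2 = 4 * σ ^ 2 * n := by rw [hs, mul_pow, mul_pow, Real.sq_sqrt hn'.le]; ring
  set Z : ℝ := n / 2 * (∫ ω, risk x η (fhat ω) ∂P - risk x η (f j)) with hZ
  have hZle : Z ≤ s * Real.sqrt (2 * Real.log M) := by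
    refine le_mul_sqrt_of_forall_mul_le (by positivity) (Real.log_nonneg hM') fun lam hlam => ?_
    set b : ℝ := Real.log M + lam ^ 2 * s ^ 2 / 2 with hb
    set W : Fin M → (Fin n → ℝ) → ℝ := fun k y =>
      Real.exp (∑ i, lam * (f k (x i) - f j (x i)) * (y i - η (x i))) with hW
    have hWi : ∀ k, Integrable (fun ω => W k (Y ω)) P := fun k => by
      have : Integrable (W k) (P.map Y) := by
        rw [hY.map_eq]; exact integrable_exp_noise _
      exact this.comp_aemeasurable hY.aemeasurable
    have hWint : ∀ k, ∫ ω, W k (Y ω) ∂P ≤ Real.exp (lam ^ 2 * s ^ 2 / 2) := fun k => by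
      have e : ∫ ω, W k (Y ω) ∂P = ∫ y, W k y ∂(dataLaw x η σ) := by
        rw [← hY.map_eq, integral_map hY.aemeasurable]
        rw [hY.map_eq]; exact (integrable_exp_noise _).aestronglyMeasurable
      rw [e, hW, integral_exp_noise, Real.exp_le_exp, hs2]
      have h1 : ∑ i, (lam * (f k (x i) - f j (x i))) ^ 2 ≤ lam ^ 2 * (4 * n) := by
        simp_rw [mul_pow]
        rw [← Finset.mul_sum]
        gcongr
        calc ∑ i, (f k (x i) - f j (x i)) ^ 2
            ≤ ∑ i, (2 * f k (x i) ^ 2 + 2 * f j (x i) ^ 2) :=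
              Finset.sum_le_sum fun i _ => by nlinarith [sq_nonneg (f k (x i) + f j (x i))]
          _ = 2 * ∑ i, f k (x i) ^ 2 + 2 * ∑ i, f j (x i) ^ 2 := by
              rw [Finset.sum_add_distrib, Finset.mul_sum, Finset.mul_sum]
          _ ≤ 4 * n := by
              linarith [(empNorm_le_one_iff x hn).1 (hf k), (empNorm_le_one_iff x hn).1 (hf j)]
      calc (σ : ℝ) ^ 2 / 2 * ∑ i, (lam * (f k (x i) - f j (x i))) ^ 2
          ≤ (σ : ℝ) ^ 2 / 2 * (lam ^ 2 * (4 * n)) := by gcongr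
        _ = _ := by ring
    have hpt : ∀ ω, lam * (n / 2) * (risk x η (fhat ω) - risk x η (f j)) ≤
        b - 1 + Real.exp (-b) * ∑ k, W k (Y ω) := by
      intro ω
      obtain ⟨k, hk⟩ := hfhat.mem ω
      have h1 := risk_le_of_empRisk_le (η := η) (hfhat.le ω j)
      rw [← hk] at h1 ⊢
      set T := ∑ i, (f k (x i) - f j (x i)) * (Y ω i - η (x i)) with hT
      have h2 : lam * (n / 2) * (risk x η (f k) - risk x η (f j)) ≤ lam * T := by
        have : n / 2 * (risk x η (f k) - risk x η (f j)) ≤ n / 2 * (2 / n * T) := by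
          gcongr; linarith
        have e : (n : ℝ) / 2 * (2 / n * T) = T := by field_simp
        rw [e] at this
        rw [mul_assoc]
        gcongr
      have h3 : W k (Y ω) = Real.exp (lam * T) := by
        rw [hW, hT, Finset.mul_sum]
        simp only [mul_assoc]
      have h4 : W k (Y ω) ≤ ∑ k, W k (Y ω) :=
        Finset.single_le_sum (f := fun k => W k (Y ω)) (fun k _ => (Real.exp_pos _).le)
          (Finset.mem_univ k)
      -- the tangent line of `exp` at `b` replaces Jensen's inequality
      have h5 := Real.add_one_le_exp (-b + lam * T)
      rw [Real.exp_add, ← h3] at h5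
      have h6 := mul_le_mul_of_nonneg_left h4 (Real.exp_pos (-b)).le
      linarith
    have hri := integrable_risk (P := P) hfhat.mem hfhat.measurable η
    have hint := integral_mono ((hri.sub (integrable_const (risk x η (f j)))).const_mul
        (lam * (n / 2)))
      ((integrable_const (b - 1)).add
        ((integrable_finsetSum Finset.univ fun k _ => hWi k).const_mul (Real.exp (-b)))) hpt
    have eL : ∫ ω, lam * (n / 2) * (risk x η (fhat ω) - risk x η (f j)) ∂P = lam * Z := by
      rw [integral_const_mul, integral_sub hri (integrable_const _), hZ]
      simp
      ring
    have eR : ∫ ω, (b - 1 + Real.exp (-b) * ∑ k, W k (Y ω)) ∂P =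
        b - 1 + Real.exp (-b) * ∑ k, ∫ ω, W k (Y ω) ∂P := by
      rw [integral_add (integrable_const _)
        ((integrable_finsetSum Finset.univ fun k _ => hWi k).const_mul _),
        integral_const_mul, integral_finsetSum _ fun k _ => hWi k]
      simp
    have hsum : Real.exp (-b) * ∑ k, ∫ ω, W k (Y ω) ∂P ≤ 1 := by
      calc Real.exp (-b) * ∑ k, ∫ ω, W k (Y ω) ∂P
          ≤ Real.exp (-b) * ∑ _k : Fin M, Real.exp (lam ^ 2 * s ^ 2 / 2) := by
            gcongr with k; exact hWint k
        _ = Real.exp (-b) * Real.exp b := by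
            rw [hb, Real.exp_add (Real.log M), Real.exp_log (by linarith)]; simp
        _ = 1 := by rw [← Real.exp_add]; simp
    have hint' : ∫ ω, lam * (n / 2) * (risk x η (fhat ω) - risk x η (f j)) ∂P ≤
        ∫ ω, (b - 1 + Real.exp (-b) * ∑ k, W k (Y ω)) ∂P := hint
    rw [eL, eR] at hint'
    linarith
  have e : ∫ ω, risk x η (fhat ω) ∂P = risk x η (f j) + 2 / n * Z := by
    rw [hZ]; field_simp; ring
  rw [e]
  have h7 : 2 / n * (s * Real.sqrt (2 * Real.log M)) =
      4 * (σ : ℝ) * Real.sqrt (2 * Real.log M / n) := by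
    rw [Real.sqrt_div' _ hn'.le, hs]
    have h0 : Real.sqrt n ≠ 0 := (Real.sqrt_pos.2 hn').ne'
    field_simp
    rw [Real.sq_sqrt hn'.le]
    ring
  rw [← h7]
  gcongr

/-! ### The lower bound for selectors -/

theorem sum_sq_of_mem_signVectors {w : Fin n → ℝ} (hw : w ∈ signVectors n) :
    ∑ i, w i ^ 2 = n := by
  rw [mem_signVectors] at hw
  have : ∀ i, w i ^ 2 = 1 := fun i => by rcases hw i with h | h <;> rw [h] <;> norm_num
  simp [this]

/-- For `η = t f_k`, every other function of the dictionary has risk larger by at least `t`. -/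
theorem risk_add_le_of_separated (hn : 1 ≤ n) {x : Fin n → 𝒳} {η g h : 𝒳 → ℝ} {u w : Fin n → ℝ}
    (hu : u ∈ signVectors n) (hw : w ∈ signVectors n) (huw : ∑ i, u i * w i ≤ n / 2) {t : ℝ}
    (ht : 0 ≤ t) (hg : ∀ i, g (x i) = u i) (hh : ∀ i, h (x i) = w i)
    (hη : ∀ i, η (x i) = t * w i) : risk x η h + t ≤ risk x η g := by
  have hn' : (0 : ℝ) < n := by exact_mod_cast hn
  have hu2 := sum_sq_of_mem_signVectors hu
  have hw2 := sum_sq_of_mem_signVectors hw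
  simp only [risk, hg, hh, hη]
  have e1 : ∑ i, (u i - t * w i) ^ 2 = n - 2 * t * ∑ i, u i * w i + t ^ 2 * n := by
    nth_rw 1 [← hu2]
    rw [← hw2, Finset.mul_sum, Finset.mul_sum, ← Finset.sum_sub_distrib, ← Finset.sum_add_distrib]
    exact Finset.sum_congr rfl fun i _ => by ring
  have e2 : ∑ i, (w i - t * w i) ^ 2 = (1 - t) ^ 2 * n := by
    rw [← hw2, Finset.mul_sum]
    exact Finset.sum_congr rfl fun i _ => by ring
  rw [e1, e2]
  have h3 : t * ∑ i, u i * w i ≤ t * (n / 2) := by gcongr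
  have e4 : 1 / (n : ℝ) * ((1 - t) ^ 2 * n) + t =
      1 / n * (n - 2 * (t * (n / 2)) + t ^ 2 * n) := by field_simp; ring
  rw [e4]
  exact mul_le_mul_of_nonneg_left (by linarith) (by positivity)

/-- The lower bound for selectors, with `C₀ = 1 / 3` and `C_* = 1 / 10`: the separated sign vectors
form a dictionary which is bad for every selector, with a regression function `t f k`. -/
theorem exists_dictionary_lower_bound {n M : ℕ} (hn : 1 ≤ n) (hM : 1 ≤ M) (σ : ℝ≥0)
    (x : Fin n → 𝒳) (hx : Function.Injective x)
    (hC : max (σ : ℝ) 1 * Real.sqrt (Real.log M / n) ≤ 1 / 3) :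
    ∃ f : Fin M → 𝒳 → ℝ, Function.Injective f ∧ (∀ j, empNorm x (f j) ≤ 1) ∧
      ∀ S : (Fin n → ℝ) → 𝒳 → ℝ, IsSelector x f S →
        ∃ η : 𝒳 → ℝ, empNorm x η ≤ 1 ∧
          (⨅ j, risk x η (f j)) + 1 / 10 * (σ : ℝ) * Real.sqrt (Real.log M / n) ≤
            ∫ y, risk x η (S y) ∂(dataLaw x η σ) := by
  have hn' : (0 : ℝ) < n := by exact_mod_cast hn
  have hM' : (1 : ℝ) ≤ M := by exact_mod_cast hM
  have hlog : 0 ≤ Real.log M := Real.log_nonneg hM'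
  set r : ℝ := Real.sqrt (Real.log M / n) with hr
  have hr0 : 0 ≤ r := Real.sqrt_nonneg _
  have hr2 : r ^ 2 * n = Real.log M := by
    rw [hr, Real.sq_sqrt (by positivity), div_mul_cancel₀ _ hn'.ne']
  have hr3 : r ≤ 1 / 3 := by nlinarith [le_max_right (σ : ℝ) 1]
  have hσr : σ * r ≤ 1 / 3 := by nlinarith [le_max_left (σ : ℝ) 1]
  have hMexp : (M : ℝ) ≤ Real.exp (n / 8) := by
    rw [← Real.log_le_iff_le_exp (by linarith), ← hr2]
    have : r ^ 2 ≤ 1 / 9 := by nlinarith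
    nlinarith
  obtain ⟨w, hw, hsep⟩ := exists_separated_signVectors M hMexp
  have hwinj : Function.Injective w := by
    intro j k hjk
    by_contra hne
    have h1 := hsep j k hne
    rw [← hjk] at h1
    have h2 := sum_sq_of_mem_signVectors (hw j)
    simp_rw [pow_two] at h2
    rw [h2] at h1
    linarith
  set f : Fin M → 𝒳 → ℝ := fun j => Function.extend x (w j) 0 with hf
  have hfx : ∀ j i, f j (x i) = w j i := fun j i => hx.extend_apply _ _ _
  have hfinj : Function.Injective f := fun j k hjk => hwinj <| funext fun i => by
    rw [← hfx, ← hfx, hjk]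
  refine ⟨f, hfinj, fun j => ?_, fun S hS => ?_⟩
  · simp only [empNorm_le_one_iff x hn, hfx, sum_sq_of_mem_signVectors (hw j), le_refl]
  -- without noise, or with a single function, there is nothing to prove
  by_cases hdeg : σ = 0 ∨ M = 1
  · refine ⟨0, by simp [empNorm], ?_⟩
    have h0 : 1 / 10 * (σ : ℝ) * r = 0 := by
      rcases hdeg with h | h
      · simp [h]
      · simp [hr, h]
    rw [h0, add_zero]
    exact iInf_risk_le_integral hS.mem hS.measurable 0
  push Not at hdeg
  obtain ⟨hσ, hM1⟩ := hdeg
  have hσ0 : (0 : ℝ) < σ := by positivity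
  have hM2 : (2 : ℝ) ≤ M := by exact_mod_cast (show 2 ≤ M by omega)
  -- with this `t` the likelihood ratios have second moment `exp (n t² / σ²) = M ^ (1 / 4)`
  set t : ℝ := σ * r / 2 with ht
  have ht0 : 0 ≤ t := by positivity
  set η : Fin M → 𝒳 → ℝ := fun k z => t * f k z with hη
  have hηx : ∀ k i, η k (x i) = t * w k i := fun k i => by simp only [hη, hfx]
  set A : Fin M → Set (Fin n → ℝ) := fun k => {y | ∀ i, S y (x i) = w k i} with hA
  have hAm : ∀ k, MeasurableSet (A k) := fun k => by
    simp only [hA, Set.ofPred_forall]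
    exact MeasurableSet.iInter fun i =>
      measurableSet_eq_fun (hS.measurable i) measurable_const
  have hAd : Pairwise fun j k => Disjoint (A j) (A k) := fun j k hjk =>
    Set.disjoint_left.2 fun y hj hk => hjk <| hwinj <| funext fun i => by rw [← hj i, hk i]
  have hv : σ ^ 2 ≠ 0 := pow_ne_zero _ hσ
  have hlaw : ∀ k, dataLaw x (η k) σ =
      (Measure.pi fun _ : Fin n => gaussianReal 0 (σ ^ 2)).withDensity fun y =>
        ENNReal.ofReal (likelihoodRatio (σ ^ 2) (fun i => t * w k i) y) := fun k => by
    rw [← pi_gaussianReal_eq_withDensity _ hv, dataLaw]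
    simp_rw [hηx]
  have hsum : ∑ k, (dataLaw x (η k) σ).real (A k) ≤
      Real.sqrt (M * Real.exp (Real.log M / 4)) := by
    simp_rw [hlaw]
    refine sum_withDensity_disjoint_le hM _
      (fun k => likelihoodRatio (σ ^ 2) fun i => t * w k i) (fun k y => (Real.exp_pos _).le)
      (fun k => ?_)
      (fun k => integrable_likelihoodRatio_sq _) (Real.exp_pos _) (fun k => ?_) A hAm hAd
    · unfold likelihoodRatio; fun_prop
    · rw [integral_likelihoodRatio_sq _ hv]
      apply le_of_eq
      congr 1
      simp_rw [mul_pow]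
      rw [← Finset.mul_sum, sum_sq_of_mem_signVectors (hw k), ht, ← hr2]
      push_cast
      field_simp
      norm_num
  -- `√(M · M^(1/4)) = M · exp (-(3/8) log M)`, and `(3/8) log 2 ≥ 1/4`
  have hbound : Real.sqrt (M * Real.exp (Real.log M / 4)) ≤ M * (4 / 5) := by
    have hlog2 : 1 / 4 ≤ 3 / 8 * Real.log M := by
      have := Real.log_le_log (by norm_num) hM2
      have := Real.log_two_gt_d9
      linarith
    have e : (M : ℝ) * Real.exp (Real.log M / 4) = (M * Real.exp (-(3 / 8 * Real.log M))) ^ 2 := by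
      rw [mul_pow, ← Real.exp_nat_mul]
      nth_rw 1 [← Real.exp_log (show (0 : ℝ) < M by linarith)]
      nth_rw 3 [← Real.exp_log (show (0 : ℝ) < M by linarith)]
      rw [← Real.exp_nat_mul, ← Real.exp_add, ← Real.exp_add]
      congr 1
      push_cast
      ring
    rw [e, Real.sqrt_sq (by positivity)]
    gcongr
    rw [Real.exp_neg, inv_le_comm₀ (Real.exp_pos _) (by norm_num)]
    linarith [Real.add_one_le_exp (3 / 8 * Real.log M)]
  obtain ⟨k, hk⟩ : ∃ k, (dataLaw x (η k) σ).real (A k) ≤ 4 / 5 := by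
    by_contra! hcon
    have : Nonempty (Fin M) := ⟨⟨0, hM⟩⟩
    have : ∑ _k : Fin M, (4 / 5 : ℝ) < ∑ k, (dataLaw x (η k) σ).real (A k) :=
      Finset.sum_lt_sum_of_nonempty Finset.univ_nonempty fun k _ => hcon k
    simp at this
    linarith
  refine ⟨η k, ?_, ?_⟩
  · rw [empNorm_le_one_iff x hn]
    simp_rw [hηx, mul_pow]
    rw [← Finset.mul_sum, sum_sq_of_mem_signVectors (hw k)]
    have : t ^ 2 ≤ 1 := by nlinarith
    nlinarith
  have hptw : ∀ y, risk x (η k) (f k) + t - (A k).indicator (fun _ => t) y ≤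
      risk x (η k) (S y) := by
    intro y
    obtain ⟨j, hj⟩ := hS.mem y
    by_cases hjk : j = k
    · subst hjk
      have hy : y ∈ A j := fun i => by rw [← hj, hfx]
      rw [Set.indicator_of_mem hy, ← hj]
      linarith
    · have h1 := risk_add_le_of_separated (η := η k) (g := f j) (h := f k) hn (hw j) (hw k)
        (hsep j k hjk) ht0 (hfx j) (hfx k) (hηx k)
      have h2 : 0 ≤ (A k).indicator (fun _ => t) y := Set.indicator_nonneg (fun _ _ => ht0) _
      rw [← hj]
      linarith
  have hind : Integrable ((A k).indicator fun _ => t) (dataLaw x (η k) σ) :=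
    (integrable_const t).indicator (hAm k)
  have hint := integral_mono ((integrable_const (risk x (η k) (f k) + t)).sub hind)
    (integrable_risk hS.mem hS.measurable (η k)) hptw
  have eL : ∫ y, (risk x (η k) (f k) + t - (A k).indicator (fun _ => t) y)
      ∂(dataLaw x (η k) σ) =
      risk x (η k) (f k) + t - (dataLaw x (η k) σ).real (A k) * t := by
    rw [integral_sub (integrable_const _) hind, integral_indicator_const _ (hAm k)]
    simp
  have hint' : ∫ y, (risk x (η k) (f k) + t - (A k).indicator (fun _ => t) y)
      ∂(dataLaw x (η k) σ) ≤ ∫ y, risk x (η k) (S y) ∂(dataLaw x (η k) σ) := hint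
  rw [eL] at hint'
  have h1 := iInf_risk_le x (η k) f k
  have h2 := mul_le_mul_of_nonneg_right hk ht0
  have h3 : 1 / 10 * (σ : ℝ) * r = t / 5 := by rw [ht]; ring
  rw [h3]
  linarith

/-- In the lower bound the rate `√(log M / n)` dominates every multiple of `log M / n`. -/
theorem exists_dictionary_rate_lower_bound {σ : ℝ≥0} (hσ : 0 < σ) (C : ℝ) :
    ∃ δ : ℝ, 0 < δ ∧
      ∀ (𝒳 : Type u) (n M : ℕ) (_hn : 1 ≤ n) (_hM : 2 ≤ M) (x : Fin n → 𝒳)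
        (_hx : Function.Injective x) (_hδ : Real.log M / n ≤ δ),
        ∃ f : Fin M → 𝒳 → ℝ, Function.Injective f ∧
          (∀ j, empNorm x (f j) ≤ 1) ∧
          ∀ S : (Fin n → ℝ) → 𝒳 → ℝ, IsSelector x f S →
            ∃ η : 𝒳 → ℝ, empNorm x η ≤ 1 ∧
              (⨅ j, risk x η (f j)) + C * (Real.log M / n) <
                ∫ y, risk x η (S y) ∂(dataLaw x η σ) := by
  have hσ0 : (0 : ℝ) < σ := hσ
  have hm : (0 : ℝ) < max (σ : ℝ) 1 := lt_max_of_lt_right one_pos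
  set b : ℝ := min (1 / (3 * max (σ : ℝ) 1)) (σ / (10 * (|C| + 1))) with hb
  have hb0 : 0 < b := lt_min (by positivity) (by positivity)
  refine ⟨b ^ 2, by positivity, fun 𝒳 n M hn hM x hx hδ => ?_⟩
  have hn' : (0 : ℝ) < n := by exact_mod_cast hn
  have hM1 : (1 : ℝ) < M := by exact_mod_cast hM
  have hq : 0 < Real.log M / n := div_pos (Real.log_pos hM1) hn'
  have hrb : Real.sqrt (Real.log M / n) ≤ b := Real.sqrt_le_iff.2 ⟨hb0.le, hδ⟩
  have hC : max (σ : ℝ) 1 * Real.sqrt (Real.log M / n) ≤ 1 / 3 := by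
    calc max (σ : ℝ) 1 * Real.sqrt (Real.log M / n)
        ≤ max (σ : ℝ) 1 * (1 / (3 * max (σ : ℝ) 1)) := by
          gcongr; exact hrb.trans (min_le_left _ _)
      _ = 1 / 3 := by field_simp
  obtain ⟨f, hfi, hfn, hS⟩ := exists_dictionary_lower_bound hn (by omega) σ x hx hC
  refine ⟨f, hfi, hfn, fun S hsel => ?_⟩
  obtain ⟨η, hη, hle⟩ := hS S hsel
  refine ⟨η, hη, lt_of_lt_of_le ?_ hle⟩
  set r := Real.sqrt (Real.log M / n) with hr
  have hr0 : 0 < r := Real.sqrt_pos.2 hq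
  have hr2 : Real.log M / n = r * r := (Real.mul_self_sqrt hq.le).symm
  have h1 : C * r < 1 / 10 * σ := by
    have h2 : r * (10 * (|C| + 1)) ≤ σ := by
      rw [← le_div_iff₀ (by positivity)]
      exact hrb.trans (min_le_right _ _)
    nlinarith [le_abs_self C]
  rw [hr2, ← mul_assoc]
  gcongr

end FixedDesign

theorem theorem1 :
    -- upper bound: oracle inequality for every empirical risk minimizer
    (∀ (𝒳 : Type u) (n M : ℕ) (_hn : 1 ≤ n) (_hM : 1 ≤ M) (σ : ℝ≥0) (x : Fin n → 𝒳)
        (η : 𝒳 → ℝ) (f : Fin M → 𝒳 → ℝ) (_hf : ∀ j, FixedDesign.empNorm x (f j) ≤ 1)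
        (Ω : Type v) (_ : MeasurableSpace Ω) (P : Measure Ω) (_ : IsProbabilityMeasure P)
        (Y : Ω → Fin n → ℝ) (_hY : HasLaw Y (FixedDesign.dataLaw x η σ) P)
        (fhat : Ω → 𝒳 → ℝ) (_hfhat : FixedDesign.IsERM x f Y fhat),
        Integrable (fun ω => FixedDesign.risk x η (fhat ω)) P ∧
          ∫ ω, FixedDesign.risk x η (fhat ω) ∂P ≤
            (⨅ j, FixedDesign.risk x η (f j)) +
              4 * (σ : ℝ) * Real.sqrt (2 * Real.log M / n)) ∧
    -- lower bound: a dictionary that is bad for every selector, with absolute constants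
    (∃ C₀ Cstar : ℝ, 0 < C₀ ∧ C₀ < 1 ∧ 0 < Cstar ∧
      ∀ (𝒳 : Type u) (n M : ℕ) (_hn : 1 ≤ n) (_hM : 1 ≤ M) (σ : ℝ≥0) (x : Fin n → 𝒳)
        (_hx : Function.Injective x)
        (_hC : max (σ : ℝ) 1 * Real.sqrt (Real.log M / n) ≤ C₀),
        ∃ f : Fin M → 𝒳 → ℝ, Function.Injective f ∧
          (∀ j, FixedDesign.empNorm x (f j) ≤ 1) ∧
          ∀ S : (Fin n → ℝ) → 𝒳 → ℝ, FixedDesign.IsSelector x f S →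
            ∃ η : 𝒳 → ℝ, FixedDesign.empNorm x η ≤ 1 ∧
              (⨅ j, FixedDesign.risk x η (f j)) +
                  Cstar * (σ : ℝ) * Real.sqrt (Real.log M / n) ≤
                ∫ y, FixedDesign.risk x η (S y) ∂(FixedDesign.dataLaw x η σ)) ∧
    -- hence selectors cannot attain the rate `(log M) / n`
    (∀ (σ : ℝ≥0) (_hσ : 0 < σ) (C : ℝ), ∃ δ : ℝ, 0 < δ ∧
      ∀ (𝒳 : Type u) (n M : ℕ) (_hn : 1 ≤ n) (_hM : 2 ≤ M) (x : Fin n → 𝒳)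
        (_hx : Function.Injective x) (_hδ : Real.log M / n ≤ δ),
        ∃ f : Fin M → 𝒳 → ℝ, Function.Injective f ∧
          (∀ j, FixedDesign.empNorm x (f j) ≤ 1) ∧
          ∀ S : (Fin n → ℝ) → 𝒳 → ℝ, FixedDesign.IsSelector x f S →
            ∃ η : 𝒳 → ℝ, FixedDesign.empNorm x η ≤ 1 ∧
              (⨅ j, FixedDesign.risk x η (f j)) + C * (Real.log M / n) <
                ∫ y, FixedDesign.risk x η (S y) ∂(FixedDesign.dataLaw x η σ)) := by
  refine ⟨fun 𝒳 n M hn hM σ x η f hf Ω _ P _ Y hY fhat hfhat => ?_,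
    ⟨1 / 3, 1 / 10, by norm_num, by norm_num, by norm_num,
      fun 𝒳 n M hn hM σ x hx hC =>
        FixedDesign.exists_dictionary_lower_bound hn hM σ x hx hC⟩,
    fun σ hσ C => FixedDesign.exists_dictionary_rate_lower_bound hσ C⟩
  have : Nonempty (Fin M) := ⟨⟨0, hM⟩⟩
  refine ⟨FixedDesign.integrable_risk hfhat.mem hfhat.measurable η, ?_⟩
  rw [← sub_le_iff_le_add]
  exact le_ciInf fun j => sub_le_iff_le_add.2
    (FixedDesign.integral_risk_erm_le hn hf hY hfhat j)
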